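/- Let $n,k,r$ be positive integers. Let $\mathcal P^r(V_{n,k})$ be the complex vector space of homogeneous polynomials of degree $r$ in the commuting variables $x_{ij}$, $1\le i\le n$, $1\le j\le k$, i.e. of homogeneous polynomial functions of degree $r$ on the space $V_{n,k}=(\mathbb C^n)^k$ of $n\times k$ matrices. The symmetric group $S_n$ permutes the rows of these matrices and acts on polynomials by $(\sigma f)(v)=f(\sigma^{-1}v)$, that is, by the algebra automorphisms with $\sigma\cdot x_{ij}=x_{\sigma(i)j}$. Let $$\mathcal A_{r,k}(n)=\operatorname{End}_{S_n}\big(\mathcal P^r(V_{n,k})\big)=\{f\in\operatorname{End}_{\mathbb C}(\mathcal P^r(V_{n,k})) : f\sigma=\sigma f\ \text{for all }\sigma\in S_n\}.$$ Then $\mathcal A_{r,k}(n)$ is finite-dimensional, the infinite product $$\prod_{i\ge 0}\prod_{j\ge 0}\frac{1}{\left(1-zq^it^j\right)^{\binom{k+i-1}{i}\binom{k+j-1}{j}}}$$ converges coefficientwise in the ring $\mathbb Z[[z,q,t]]$ of formal power series (unconditionally, as a product over all pairs $(i,j)$ of non-negative integers), and $\dim_{\mathbb C}\mathcal A_{r,k}(n)$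 is equal to the coefficient of $z^nq^rt^r$ in this product. -/

import Mathlib

open scoped MvPowerSeries.WithPiTopology

namespace MultisetPartition

/-- The space `P^r(V_{n,k})` of homogeneous polynomials of degree `r` with complex coefficients in
the variables `x_{ij}`, `i : Fin n`, `j : Fin k`. -/
abbrev Poly (n k r : ℕ) : Submodule ℂ (MvPolynomial (Fin n × Fin k) ℂ) :=
  MvPolynomial.homogeneousSubmodule (Fin n × Fin k) ℂ r

/-- The action of `S_n` on `P^r(V_{n,k})` induced by permuting the rows of an `n × k` matrix:
`(σ f)(v) = f(σ⁻¹ v)`, which is the algebra action with `σ x_{ij} = x_{σ(i) j}`. -/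
noncomputable def rowAction (n k r : ℕ) :
    Representation ℂ (Equiv.Perm (Fin n)) (Poly n k r) where
  toFun σ := (MvPolynomial.rename (Prod.map σ id)).toLinearMap.restrict
    (fun _ hf => MvPolynomial.IsHomogeneous.rename_isHomogeneous hf)
  map_one' := by
    ext f
    simp
  map_mul' σ τ := by
    refine LinearMap.ext fun f => Subtype.ext ?_
    change MvPolynomial.rename (Prod.map (σ ∘ τ) id) f.1 =
      MvPolynomial.rename (Prod.map σ id) (MvPolynomial.rename (Prod.map τ id) f.1)
    rw [MvPolynomial.rename_rename, Prod.map_comp_map, Function.comp_id]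

/-- The centralizer algebra `A_{r,k}(n) = End_{S_n}(P^r(V_{n,k}))`: all linear endomorphisms of
`P^r(V_{n,k})` that commute with the action of every permutation. -/
noncomputable def centralizerAlgebra (r k n : ℕ) : Subalgebra ℂ (Module.End ℂ (Poly n k r)) :=
  Subalgebra.centralizer ℂ (Set.range (rowAction n k r))

/-- The ring `ℤ⟦z, q, t⟧`; the variables `z`, `q`, `t` have the indices `0`, `1`, `2`. It carries
the topology of coefficientwise convergence, each coefficient being in the discrete space `ℤ`. -/
abbrev Series : Type := MvPowerSeries (Fin 3) ℤ

/-- The denominator `(1 - z q^i t^j) ^ (C(k+i-1, i) C(k+j-1, j))`, for `k ≥ 1`. -/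
noncomputable def denominator (k : ℕ) (p : ℕ × ℕ) : Series :=
  (1 - MvPowerSeries.X 0 * MvPowerSeries.X 1 ^ p.1 * MvPowerSeries.X 2 ^ p.2) ^
    ((k + p.1 - 1).choose p.1 * (k + p.2 - 1).choose p.2)

/-- The factor `1 / (1 - z q^i t^j) ^ (C(k+i-1, i) C(k+j-1, j))`: the multiplicative inverse
of a power series whose constant coefficient is `1`. -/
noncomputable def factor (k : ℕ) (p : ℕ × ℕ) : Series :=
  MvPowerSeries.invOfUnit (denominator k p) 1

theorem denominator_mul_factor (k : ℕ) (p : ℕ × ℕ) : denominator k p * factor k p = 1 :=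
  MvPowerSeries.mul_invOfUnit _ _ (by simp [denominator])

/-- The exponent of the monomial `z^n q^a t^b`. -/
noncomputable def exponent (n a b : ℕ) : Fin 3 →₀ ℕ :=
  Finsupp.single 0 n + Finsupp.single 1 a + Finsupp.single 2 b

end MultisetPartition

/-!
The monomials of degree `r` form a basis of `P^r(V_{n,k})` which `S_n` permutes. An endomorphism
commutes with `S_n` exactly when its matrix in this basis is constant on the orbits of `S_n` on pairs
of monomials, so the dimension of the centralizer algebra is the number of these orbits
(`finrank_centralizer_eq_card`).

A pair of monomials is a pair of `n × k` exponent matrices, that is, a family of `n` rows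
`(u, v) ∈ ℕ^k × ℕ^k`, and `S_n` permutes the rows. Hence the orbits are the multisets of `n` rows
whose bidegrees `(|u|, |v|)` add up to `(r, r)` (`rowMultiset_eq_iff`, `rowMultiset_surjective`).

Giving a row of bidegree `(i, j)` the weight `z q^i t^j`, the generating series of multisets of rows is
the product of `1 / (1 - z q^i t^j)` over all rows (`prod_one_sub_monomial_mul_multisetSeries`), and
there are `C(k+i-1, i) C(k+j-1, j)` rows of bidegree `(i, j)` (`card_rowsOfBidegree`). A multiset of
given weight only involves rows of bounded bidegree, so the coefficients of the finite products are
eventually constant; this yields convergence and the value of the product at once (`hasProd_factor`).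
-/

namespace MultisetPartition

/-! ### Centralizers of permutations of a basis -/

theorem repr_permutation {K V X : Type*} [Field K] [AddCommGroup V] [Module K V]
    (b : Module.Basis X K V) (s : Equiv.Perm X) (T : Module.End K V)
    (hT : ∀ x, T (b x) = b (s x)) (v : V) (x : X) : b.repr (T v) (s x) = b.repr v x := by
  classical
  suffices h : b.coord (s x) ∘ₗ T = b.coord x from LinearMap.congr_fun h v
  exact b.ext fun y => by simp [hT, Finsupp.single_apply]

/-- An endomorphism commutes with a permutation of a basis exactly when its matrix is invariant under
the simultaneous permutation of rows and columns. -/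
theorem commute_iff_repr_invariant {K V X : Type*} [Field K] [AddCommGroup V] [Module K V]
    (b : Module.Basis X K V) (s : Equiv.Perm X) (T : Module.End K V)
    (hT : ∀ x, T (b x) = b (s x)) (f : Module.End K V) :
    T * f = f * T ↔ ∀ x y, b.repr (f (b (s y))) (s x) = b.repr (f (b y)) x := by
  constructor
  · intro h x y
    rw [← hT y, ← Module.End.mul_apply, ← h, Module.End.mul_apply, repr_permutation b s T hT]
  · intro h
    refine b.ext fun y => b.repr.injective (Finsupp.ext fun x => ?_)
    obtain ⟨x, rfl⟩ := s.surjective x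
    rw [Module.End.mul_apply, repr_permutation b s T hT, Module.End.mul_apply, hT, h]

/-- The centralizer of a family of permutations of a basis `X` has dimension the number of orbits on
`X × X`. The orbit space is presented as a type `M` with a surjection `Φ` whose fibres are the orbits,
so no group structure on the index type `G` is needed. -/
theorem finrank_centralizer_eq_card {K V X G M : Type*} [Field K] [AddCommGroup V]
    [Module K V] [Finite X] (b : Module.Basis X K V) (act : G → Equiv.Perm X)
    (ρ : G → Module.End K V) (hρ : ∀ g x, ρ g (b x) = b (act g x))
    (Φ : X × X → M) (hsurj : Function.Surjective Φ)
    (hΦ : ∀ p q, Φ p = Φ q ↔ ∃ g, act g p.1 = q.1 ∧ act g p.2 = q.2) :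
    Module.finrank K (Subalgebra.centralizer K (Set.range ρ)) = Nat.card M := by
  classical
  have := Fintype.ofFinite X
  have := Finite.of_surjective Φ hsurj
  have := Fintype.ofFinite M
  let E : Module.End K V ≃ₗ[K] (X × X → K) :=
    (LinearMap.toMatrix b b).trans (LinearEquiv.curry K K X X).symm
  have hE : ∀ f x y, E f (x, y) = b.repr (f (b y)) x := fun f x y =>
    LinearMap.toMatrix_apply b b f x y
  -- In matrix entries the centralizer consists of the functions on `X × X` that factor through `Φ`.
  have hmap : (Subalgebra.toSubmodule (Subalgebra.centralizer K (Set.range ρ))).map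
      (E : Module.End K V →ₗ[K] (X × X → K)) = LinearMap.range (LinearMap.funLeft K K Φ) := by
    ext u
    obtain ⟨f, rfl⟩ := E.surjective u
    rw [← LinearEquiv.coe_coe, Submodule.mem_map_equiv]
    simp only [LinearEquiv.coe_coe, LinearEquiv.symm_apply_apply, Subalgebra.mem_toSubmodule,
      Subalgebra.mem_centralizer_iff, Set.forall_mem_range, LinearMap.mem_range,
      commute_iff_repr_invariant b (act _) (ρ _) (hρ _), ← hE]
    constructor
    · intro h
      refine ⟨fun m => E f (Function.surjInv hsurj m), funext fun p => ?_⟩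
      obtain ⟨g, h1, h2⟩ := (hΦ _ _).1 (Function.surjInv_eq hsurj (Φ p)).symm
      rw [LinearMap.funLeft_apply, ← h g p.1 p.2, h1, h2]
    · rintro ⟨c, hc⟩ g x y
      rw [← hc, LinearMap.funLeft_apply, LinearMap.funLeft_apply,
        (hΦ (x, y) (act g x, act g y)).2 ⟨g, rfl, rfl⟩]
  calc Module.finrank K (Subalgebra.centralizer K (Set.range ρ))
      = Module.finrank K ((Subalgebra.toSubmodule (Subalgebra.centralizer K (Set.range ρ))).map
          (E : Module.End K V →ₗ[K] (X × X → K))) :=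
        (LinearEquiv.finrank_map_eq E
          (Subalgebra.toSubmodule (Subalgebra.centralizer K (Set.range ρ)))).symm
    _ = Module.finrank K (M → K) := by
      rw [hmap, LinearMap.finrank_range_of_inj
        (LinearMap.funLeft_injective_of_surjective K K Φ hsurj)]
    _ = Nat.card M := by rw [Module.finrank_fintype_fun_eq_card, Nat.card_eq_fintype_card]

/-! ### Generating series of multisets -/

/-- Two finite families have the same multiset of values exactly when they differ by a permutation of
the index type: orbits of `Perm ι` on `ι → Y` are multisets. -/
theorem map_univ_eq_map_univ_iff {ι Y : Type*} [Fintype ι] (u v : ι → Y) :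
    Finset.univ.val.map u = Finset.univ.val.map v ↔ ∃ σ : Equiv.Perm ι, ∀ i, v (σ i) = u i := by
  classical
  constructor
  · intro h
    have hc : ∀ c, Nonempty ({i // u i = c} ≃ {i // v i = c}) := fun c => by
      have := congrArg (Multiset.count c) h
      rw [Multiset.count_map, Multiset.count_map] at this
      refine Fintype.card_eq.1 ?_
      rw [Fintype.card_subtype, Fintype.card_subtype]
      simpa [Finset.card_def, Finset.filter_val, eq_comm] using this
    exact ⟨Equiv.ofFiberEquiv fun c => (hc c).some, fun i => Equiv.ofFiberEquiv_map _ i⟩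
  · rintro ⟨σ, hσ⟩
    conv_rhs => rw [← Multiset.map_univ_val_equiv σ, Multiset.map_map]
    exact (Multiset.map_congr rfl fun i _ => hσ i).symm

/-- The generating series of multisets of elements of `T` by total weight: the coefficient at `d` is
the number of multisets `m` in `T` with `∑ y ∈ m, w y = d`. The count is `Nat.card`, hence the junk
value `0` wherever there are infinitely many such multisets. -/
noncomputable def multisetSeries {σ Y : Type*} (w : Y → σ →₀ ℕ) (T : Set Y) : MvPowerSeries σ ℤ :=
  fun d => Nat.card {m : Multiset Y // (∀ y ∈ m, y ∈ T) ∧ (m.map w).sum = d}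

theorem coeff_multisetSeries {σ Y : Type*} (w : Y → σ →₀ ℕ) (T : Set Y) (d : σ →₀ ℕ) :
    MvPowerSeries.coeff d (multisetSeries w T) =
      Nat.card {m : Multiset Y // (∀ y ∈ m, y ∈ T) ∧ (m.map w).sum = d} := rfl

/-- A multiset of weight `d` in `T` has at most `d.degree` elements, because every weight is nonzero,
so it lies below `d.degree • T`. -/
theorem finite_multisets {σ Y : Type*} (w : Y → σ →₀ ℕ) (hw : ∀ y, w y ≠ 0) (T : Finset Y)
    (d : σ →₀ ℕ) : Finite {m : Multiset Y // (∀ y ∈ m, y ∈ (T : Set Y)) ∧ (m.map w).sum = d} := by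
  classical
  refine Set.Finite.subset (Set.finite_Iic (d.degree • T.val)) ?_
  rintro m ⟨hT, rfl⟩
  refine Multiset.le_iff_count.2 fun y => ?_
  by_cases hy : y ∈ m
  · rw [Multiset.count_nsmul, Multiset.count_eq_one_of_mem T.nodup (hT y hy), mul_one]
    have key : ∀ m : Multiset Y, m.card ≤ ((m.map w).sum).degree := fun m => by
      induction m using Multiset.induction with
      | empty => simp
      | cons a m ih =>
        have : 0 < (w a).degree :=
          Nat.pos_of_ne_zero fun h => hw a ((Finsupp.degree_eq_zero_iff _).1 h)
        simp only [Multiset.card_cons, Multiset.map_cons, Multiset.sum_cons, map_add]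
        lia
    exact (Multiset.count_le_card _ _).trans (key m)
  · simp [Multiset.count_eq_zero_of_notMem hy]

/-- Multisets in `T ∪ {a}` either avoid `a` or arise from a smaller one by adding a copy of `a`. -/
theorem one_sub_monomial_mul_multisetSeries {σ Y : Type*} (w : Y → σ →₀ ℕ) (hw : ∀ y, w y ≠ 0)
    (T : Finset Y) (a : Y) (ha : a ∉ T) :
    (1 - MvPowerSeries.monomial (w a) 1) * multisetSeries w (insert a (T : Set Y)) =
      multisetSeries w (T : Set Y) := by
  classical
  ext d
  rw [sub_mul, one_mul, map_sub, sub_eq_iff_eq_add, MvPowerSeries.coeff_monomial_mul, one_mul]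
  simp only [coeff_multisetSeries]
  let P : Multiset Y → Prop := fun m => (∀ y ∈ m, y ∈ insert a (T : Set Y)) ∧ (m.map w).sum = d
  have hfin : Finite {m // P m} := by
    have := finite_multisets w hw (insert a T) d
    simpa only [Finset.coe_insert] using this
  have hsplit : Nat.card {m // P m} = Nat.card {m : {m // P m} // ¬ a ∈ m.1} +
      Nat.card {m : {m // P m} // a ∈ m.1} := by
    rw [← Nat.card_sum]
    exact Nat.card_congr ((Equiv.sumComm _ _).trans
      (Equiv.sumCompl fun m : {m // P m} => a ∈ m.1)).symm
  have h1 : Nat.card {m : {m // P m} // ¬ a ∈ m.1} =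
      Nat.card {m : Multiset Y // (∀ y ∈ m, y ∈ (T : Set Y)) ∧ (m.map w).sum = d} := by
    refine Nat.card_congr ((Equiv.subtypeSubtypeEquivSubtypeInter P fun m => ¬ a ∈ m).trans
      (Equiv.subtypeEquivRight fun m => ?_))
    constructor
    · rintro ⟨⟨h, hs⟩, hm⟩
      exact ⟨fun y hy => (h y hy).resolve_left fun e => hm (e ▸ hy), hs⟩
    · rintro ⟨h, hs⟩
      exact ⟨⟨fun y hy => Or.inr (h y hy), hs⟩, fun hm => ha (h a hm)⟩
  have h2 : (Nat.card {m : {m // P m} // a ∈ m.1} : ℤ) = if w a ≤ d then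
      (Nat.card {m : Multiset Y // (∀ y ∈ m, y ∈ insert a (T : Set Y)) ∧
        (m.map w).sum = d - w a} : ℤ) else 0 := by
    split_ifs with hd
    · refine congrArg Nat.cast (Nat.card_congr
        ((Equiv.subtypeSubtypeEquivSubtypeInter P fun m => a ∈ m).trans ?_))
      refine ⟨fun m => ⟨m.1.erase a, fun y hy => m.2.1.1 y (Multiset.mem_of_mem_erase hy), ?_⟩,
        fun m => ⟨a ::ₘ m.1, ⟨fun y hy => ?_, ?_⟩, Multiset.mem_cons_self a _⟩,
        fun m => ?_, fun m => ?_⟩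
      · rw [← m.2.1.2, ← Multiset.cons_erase m.2.2]
        simp
      · exact (Multiset.mem_cons.1 hy).elim (fun e => Or.inl e) (m.2.1 y)
      · rw [Multiset.map_cons, Multiset.sum_cons, m.2.2, add_tsub_cancel_of_le hd]
      · exact Subtype.ext (Multiset.cons_erase m.2.2)
      · exact Subtype.ext (Multiset.erase_cons_head a m.1)
    · have : IsEmpty {m : {m // P m} // a ∈ m.1} := ⟨fun m => hd <| by
        have hs := m.1.2.2
        rw [← Multiset.cons_erase m.2, Multiset.map_cons, Multiset.sum_cons] at hs
        exact hs ▸ le_self_add⟩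
      simp
  rw [← h2, ← h1]
  rw [← Nat.cast_add, ← hsplit]

/-- The geometric product formula `∑ₘ X ^ w(m) = ∏_{y ∈ T} 1 / (1 - X ^ w(y))` for a finite set `T`,
cleared of denominators. -/
theorem prod_one_sub_monomial_mul_multisetSeries {σ Y : Type*} (w : Y → σ →₀ ℕ)
    (hw : ∀ y, w y ≠ 0) (T : Finset Y) :
    (∏ y ∈ T, (1 - MvPowerSeries.monomial (w y) 1)) * multisetSeries w (T : Set Y) = 1 := by
  classical
  induction T using Finset.induction_on with
  | empty =>
    ext d
    rw [Finset.prod_empty, one_mul, coeff_multisetSeries, MvPowerSeries.coeff_one]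
    split_ifs with hd
    · subst hd
      have : Unique {m : Multiset Y // (∀ y ∈ m, y ∈ ((∅ : Finset Y) : Set Y)) ∧
          (m.map w).sum = 0} :=
        ⟨⟨⟨0, by simp⟩⟩, fun m => Subtype.ext (Multiset.eq_zero_of_forall_notMem
          fun y hy => by simpa using m.2.1 y hy)⟩
      rw [Nat.card_unique, Nat.cast_one]
    · have : IsEmpty {m : Multiset Y // (∀ y ∈ m, y ∈ ((∅ : Finset Y) : Set Y)) ∧
          (m.map w).sum = d} := ⟨fun m => hd <| by
        have h0 : m.1 = 0 := Multiset.eq_zero_of_forall_notMem fun y hy => by simpa using m.2.1 y hy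
        simpa [h0] using m.2.2.symm⟩
      rw [Nat.card_of_isEmpty, Nat.cast_zero]
  | insert a T ha ih =>
    rw [Finset.prod_insert ha, mul_comm (1 - _), mul_assoc, Finset.coe_insert,
      one_sub_monomial_mul_multisetSeries w hw T a ha, ih]


/-! ### The infinite product -/

theorem exponent_apply_one (n a b : ℕ) : exponent n a b 1 = a := by
  simp [exponent]

theorem exponent_apply_two (n a b : ℕ) : exponent n a b 2 = b := by
  simp [exponent]

theorem exponent_apply_zero (n a b : ℕ) : exponent n a b 0 = n := by
  simp [exponent]

theorem sum_exponent {ι : Type*} (s : Finset ι) (n a b : ι → ℕ) :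
    ∑ i ∈ s, exponent (n i) (a i) (b i) = exponent (∑ i ∈ s, n i) (∑ i ∈ s, a i) (∑ i ∈ s, b i) := by
  simp [exponent, Finset.sum_add_distrib, Finsupp.single_finsetSum]

/-- A row of a pair of exponent matrices: a pair of exponent vectors in `k` variables. -/
abbrev Row (k : ℕ) : Type := (Fin k →₀ ℕ) × (Fin k →₀ ℕ)

/-- The pair of total degrees of a pair of exponent vectors. -/
noncomputable def bidegree {k : ℕ} (y : Row k) : ℕ × ℕ := (y.1.degree, y.2.degree)

/-- The exponent of `z q^i t^j`, where `(i, j)` is the bidegree of the row: `z` counts rows. -/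
noncomputable def rowWeight {k : ℕ} (y : Row k) : Fin 3 →₀ ℕ :=
  exponent 1 (bidegree y).1 (bidegree y).2

theorem rowWeight_ne_zero {k : ℕ} (y : Row k) : rowWeight y ≠ 0 := fun h => by
  simpa [rowWeight, exponent_apply_zero] using DFunLike.congr_fun h 0

/-- The finite set of pairs of exponent vectors of bidegree `p`. -/
noncomputable def rowsOfBidegree (k : ℕ) (p : ℕ × ℕ) : Finset (Row k) :=
  Finset.univ.finsuppAntidiag p.1 ×ˢ Finset.univ.finsuppAntidiag p.2

theorem mem_rowsOfBidegree {k : ℕ} {p : ℕ × ℕ} {y : Row k} :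
    y ∈ rowsOfBidegree k p ↔ bidegree y = p := by
  simp [rowsOfBidegree, bidegree, Prod.ext_iff, Finsupp.degree_eq_sum]

theorem card_rowsOfBidegree (k : ℕ) (p : ℕ × ℕ) : (rowsOfBidegree k p).card =
    (k + p.1 - 1).choose p.1 * (k + p.2 - 1).choose p.2 := by
  simp [rowsOfBidegree, Finset.card_finsuppAntidiag_nat_eq_choose]

theorem monomial_exponent_one (i j : ℕ) : (MvPowerSeries.monomial (exponent 1 i j) 1 : Series) =
    MvPowerSeries.X 0 * MvPowerSeries.X 1 ^ i * MvPowerSeries.X 2 ^ j := by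
  rw [MvPowerSeries.X, MvPowerSeries.X_pow_eq, MvPowerSeries.X_pow_eq,
    MvPowerSeries.monomial_mul_monomial, MvPowerSeries.monomial_mul_monomial, one_mul, one_mul,
    exponent]

/-- The exponent of the denominator counts the rows of bidegree `p`, so that the denominator is a
product with one factor for each of these rows. -/
theorem denominator_eq_prod (k : ℕ) (p : ℕ × ℕ) : denominator k p =
    ∏ y ∈ rowsOfBidegree k p, (1 - MvPowerSeries.monomial (rowWeight y) 1) := by
  rw [denominator, ← card_rowsOfBidegree, ← monomial_exponent_one, ← Finset.prod_const]
  refine Finset.prod_congr rfl fun y hy => ?_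
  rw [rowWeight, mem_rowsOfBidegree.1 hy]

/-- A finite product of the factors enumerates multisets of rows whose bidegrees lie in `s`; both sides
are inverse to the product of the denominators. -/
theorem prod_factor (k : ℕ) (s : Finset (ℕ × ℕ)) :
    ∏ p ∈ s, factor k p = multisetSeries (rowWeight (k := k)) {y | bidegree y ∈ s} := by
  classical
  have hset : {y : Row k | bidegree y ∈ s} = (s.biUnion (rowsOfBidegree k) : Finset (Row k)) := by
    ext y
    simp [mem_rowsOfBidegree]
  have hdisj : (s : Set (ℕ × ℕ)).PairwiseDisjoint (rowsOfBidegree k) := fun p _ q _ hpq =>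
    Finset.disjoint_left.2 fun y hp hq =>
      hpq ((mem_rowsOfBidegree.1 hp).symm.trans (mem_rowsOfBidegree.1 hq))
  have h1 : (∏ p ∈ s, denominator k p) * ∏ p ∈ s, factor k p = 1 := by
    rw [← Finset.prod_mul_distrib]
    exact Finset.prod_eq_one fun p _ => denominator_mul_factor k p
  have h2 : (∏ p ∈ s, denominator k p) *
      multisetSeries (rowWeight (k := k)) {y | bidegree y ∈ s} = 1 := by
    rw [hset, ← prod_one_sub_monomial_mul_multisetSeries rowWeight rowWeight_ne_zero,
      Finset.prod_biUnion hdisj]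
    simp only [denominator_eq_prod]
  exact (left_inv_eq_right_inv ((mul_comm _ _).trans h1) h2)

/-- The product converges to the generating series of all multisets of rows. -/
theorem hasProd_factor (k : ℕ) :
    HasProd (factor k) (multisetSeries (rowWeight (k := k)) Set.univ) := by
  rw [HasProd, SummationFilter.unconditional_filter,
    MvPowerSeries.WithPiTopology.tendsto_iff_coeff_tendsto]
  intro d
  -- Rows in a multiset of weight `d` have bidegree at most `(d 1, d 2)`, so the coefficient at `d` is
  -- constant once the finite product contains all these bidegrees.
  refine tendsto_const_nhds.congr' ?_
  filter_upwards [Filter.eventually_ge_atTop (Finset.Iic (d 1, d 2))] with s hs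
  rw [prod_factor, coeff_multisetSeries, coeff_multisetSeries]
  refine congrArg Nat.cast (Nat.card_congr (Equiv.subtypeEquivRight fun m => ?_))
  refine and_congr_left fun hm => ⟨fun _ y hy => hs ?_, fun _ _ _ => Set.mem_univ _⟩
  have hle : rowWeight y ≤ d := hm ▸ Multiset.single_le_sum (fun _ _ => zero_le) _
    (Multiset.mem_map_of_mem _ hy)
  have h1 := hle 1
  have h2 := hle 2
  rw [rowWeight, exponent_apply_one] at h1
  rw [rowWeight, exponent_apply_two] at h2
  exact Finset.mem_Iic.2 ⟨h1, h2⟩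

/-! ### Orbits of pairs of monomials -/

/-- The exponents of the monomials of degree `r` in the variables `x_{ij}`, as `n × k` matrices. -/
abbrev Exponents (n k r : ℕ) : Type := {d : Fin n × Fin k →₀ ℕ // d.degree = r}

instance finite_exponents (n k r : ℕ) : Finite (Exponents n k r) := by
  classical
  refine Set.Finite.subset (Finset.univ.finsuppAntidiag r).finite_toSet fun d hd => ?_
  rw [Finset.mem_coe, Finset.mem_finsuppAntidiag, ← Finsupp.degree_eq_sum]
  exact ⟨hd, Finset.subset_univ _⟩

/-- The basis of `P^r(V_{n,k})` formed by the monomials of degree `r`. -/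
noncomputable def monomialBasis (n k r : ℕ) : Module.Basis (Exponents n k r) ℂ (Poly n k r) :=
  .ofRepr ((LinearEquiv.ofEq _ _
    (MvPolynomial.homogeneousSubmodule_eq_finsupp_supported (Fin n × Fin k) ℂ r)).trans
      (AddMonoidAlgebra.supportedEquivFinsupp _))

theorem coe_monomialBasis {n k r : ℕ} (d : Exponents n k r) :
    (monomialBasis n k r d : MvPolynomial (Fin n × Fin k) ℂ) = MvPolynomial.monomial d.1 1 := by
  classical
  suffices h : monomialBasis n k r d =
      ⟨MvPolynomial.monomial d.1 1, MvPolynomial.isHomogeneous_monomial 1 d.2⟩ from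
    congrArg Subtype.val h
  refine (monomialBasis n k r).repr.injective (Finsupp.ext fun e => ?_)
  rw [Module.Basis.repr_self, Finsupp.single_apply]
  change _ = MvPolynomial.coeff e.1 (MvPolynomial.monomial d.1 (1 : ℂ))
  rw [MvPolynomial.coeff_monomial]
  simp only [Subtype.ext_iff]

/-- The action of a permutation on the rows of an exponent matrix. -/
noncomputable def permuteRows {n k r : ℕ} (σ : Equiv.Perm (Fin n)) :
    Equiv.Perm (Exponents n k r) :=
  (Finsupp.domCongr (σ.prodCongr (Equiv.refl (Fin k)))).toEquiv.subtypeEquiv fun d => by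
    change _ ↔ (Finsupp.equivMapDomain _ d).degree = r
    rw [Finsupp.degree_eq_sum, Finsupp.degree_eq_sum]
    exact Eq.congr_left (Equiv.sum_comp (σ.prodCongr (Equiv.refl (Fin k))).symm d).symm

theorem permuteRows_apply {n k r : ℕ} (σ : Equiv.Perm (Fin n)) (d : Exponents n k r)
    (i : Fin n) (j : Fin k) : (permuteRows σ d).1 (σ i, j) = d.1 (i, j) := by
  simp [permuteRows]

theorem rowAction_monomialBasis {n k r : ℕ} (σ : Equiv.Perm (Fin n)) (d : Exponents n k r) :
    rowAction n k r σ (monomialBasis n k r d) = monomialBasis n k r (permuteRows σ d) := by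
  refine Subtype.ext ?_
  rw [coe_monomialBasis]
  change MvPolynomial.rename (Prod.map σ id) (monomialBasis n k r d).1 = _
  rw [coe_monomialBasis, MvPolynomial.rename_monomial]
  exact congrArg (MvPolynomial.monomial · (1 : ℂ))
    (Finsupp.equivMapDomain_eq_mapDomain (σ.prodCongr (Equiv.refl (Fin k))) d.1).symm

/-- The `i`-th rows of two exponent matrices, taken as a pair. -/
noncomputable def rows {n k : ℕ} (d e : Fin n × Fin k →₀ ℕ) (i : Fin n) : Row k :=
  (d.curry i, e.curry i)

theorem sum_rowWeight_rows {n k : ℕ} (d e : Fin n × Fin k →₀ ℕ) :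
    ((Finset.univ.val.map (rows d e)).map rowWeight).sum = exponent n d.degree e.degree := by
  rw [Multiset.map_map]
  change ∑ i, exponent 1 (d.curry i).degree (e.curry i).degree = _
  rw [sum_exponent]
  simp [Finsupp.degree_eq_sum, Fintype.sum_prod_type]

/-- The multiset of rows of a pair of exponent matrices of degree `r`. It forgets the order of the rows
and thus parametrizes the orbits of `S_n` on such pairs. The vacuous membership condition matches the
coefficients of `multisetSeries rowWeight Set.univ`. -/
noncomputable def rowMultiset (n k r : ℕ) (p : Exponents n k r × Exponents n k r) :
    {m : Multiset (Row k) // (∀ y ∈ m, y ∈ Set.univ) ∧ (m.map rowWeight).sum = exponent n r r} :=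
  ⟨Finset.univ.val.map (rows p.1.1 p.2.1), fun _ _ => Set.mem_univ _, by
    rw [sum_rowWeight_rows, p.1.2, p.2.2]⟩

theorem rowMultiset_eq_iff {n k r : ℕ} (p q : Exponents n k r × Exponents n k r) :
    rowMultiset n k r p = rowMultiset n k r q ↔
      ∃ σ : Equiv.Perm (Fin n), permuteRows σ p.1 = q.1 ∧ permuteRows σ p.2 = q.2 := by
  rw [Subtype.ext_iff]
  refine (map_univ_eq_map_univ_iff (rows p.1.1 p.2.1) (rows q.1.1 q.2.1)).trans
    (exists_congr fun σ => ?_)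
  have key : ∀ d e : Exponents n k r, permuteRows σ d = e ↔ ∀ i, e.1.curry (σ i) = d.1.curry i := by
    intro d e
    rw [Subtype.ext_iff, Finsupp.ext_iff]
    constructor
    · intro h i
      ext j
      rw [Finsupp.curry_apply, Finsupp.curry_apply, ← h, permuteRows_apply]
    · rintro h ⟨i, j⟩
      obtain ⟨i, rfl⟩ := σ.surjective i
      rw [permuteRows_apply, ← Finsupp.curry_apply, ← h, Finsupp.curry_apply]
  simp only [rows, Prod.ext_iff, key, forall_and]

/-- A multiset of weight `z^n q^r t^r` has `n` elements; listing them in any order gives the rows of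
two exponent matrices of degree `r`. -/
theorem rowMultiset_surjective (n k r : ℕ) : Function.Surjective (rowMultiset n k r) := by
  rintro ⟨m, -, hm⟩
  have hcard : m.card = n := by
    have h : ∀ m : Multiset (Row k), (m.map rowWeight).sum 0 = m.card := fun m => by
      induction m using Multiset.induction with
      | empty => simp
      | cons y m ih =>
        rw [Multiset.map_cons, Multiset.sum_cons, Finsupp.add_apply, ih, rowWeight,
          exponent_apply_zero, Multiset.card_cons, add_comm]
    rw [← h, hm, exponent_apply_zero]
  obtain ⟨l, rfl⟩ := Quot.exists_rep m
  obtain rfl : l.length = n := hcard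
  let d : Fin l.length × Fin k →₀ ℕ := Finsupp.equivFunOnFinite.symm fun x => (l.get x.1).1 x.2
  let e : Fin l.length × Fin k →₀ ℕ := Finsupp.equivFunOnFinite.symm fun x => (l.get x.1).2 x.2
  have hrows : rows d e = l.get := funext fun i =>
    Prod.ext (Finsupp.ext fun j => by simp [rows, d]) (Finsupp.ext fun j => by simp [rows, e])
  have hmap : Finset.univ.val.map (rows d e) = (l : Multiset (Row k)) := by
    rw [hrows, Fin.univ_val_map, List.ofFn_get]
  have hdeg := (sum_rowWeight_rows d e).symm.trans ((congrArg _ (congrArg _ hmap)).trans hm)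
  refine ⟨⟨⟨d, ?_⟩, ⟨e, ?_⟩⟩, Subtype.ext hmap⟩
  · simpa only [exponent_apply_one] using DFunLike.congr_fun hdeg 1
  · simpa only [exponent_apply_two] using DFunLike.congr_fun hdeg 2

end MultisetPartition

theorem mainTheorem4 (n k r : ℕ) (hn : 0 < n) (hk : 0 < k) (hr : 0 < r) :
    Multipliable (MultisetPartition.factor k) ∧
    Module.Finite ℂ (MultisetPartition.centralizerAlgebra r k n) ∧
    (Module.finrank ℂ (MultisetPartition.centralizerAlgebra r k n) : ℤ) =
      MvPowerSeries.coeff (MultisetPartition.exponent n r r)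
        (∏' p : ℕ × ℕ, MultisetPartition.factor k p) := by
  open MultisetPartition in
  refine ⟨(hasProd_factor k).multipliable, ?_, ?_⟩
  · have := Module.Finite.of_basis (monomialBasis n k r)
    exact Module.Finite.of_injective (centralizerAlgebra r k n).val.toLinearMap
      Subtype.val_injective
  · rw [(hasProd_factor k).tprod_eq, coeff_multisetSeries]
    exact congrArg Nat.cast (finrank_centralizer_eq_card (monomialBasis n k r)
      permuteRows (rowAction n k r) rowAction_monomialBasis (rowMultiset n k r)
      (rowMultiset_surjective n k r) rowMultiset_eq_iff)
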